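/- All vector spaces are real. Let $F$ be an Archimedean vector lattice, i.e. $\inf\{n^{-1}w : n=1,2,\dots\}=0$ for every $w\in F^+=\{w\in F: w\ge 0\}$, and suppose that $F$ is an $f$-algebra: it carries an associative ring multiplication such that $ab\in F^+$ for all $a,b\in F^+$, and such that $\inf\{a,b\}=0$ implies $\inf\{ac,b\}=\inf\{a,bc\}=0$ for all $c\in F^+$. Suppose that $F$ is semiprime (it has no nonzero nilpotent elements) and geometric mean closed, i.e. $\inf\{\theta a+\theta^{-1}b:\theta\in(0,\infty)\}$ exists in $F$ for all $a,b\in F^+$, and write $a\boxtimes b:=\tfrac12\inf\{\theta a+\theta^{-1}b:\theta\in(0,\infty)\}$. Let $V$ be a vector space, let $T\colon V\times V\to F$ be a vector semi-inner product, i.e. a symmetric bilinear map with $T(x,x)\ge 0$ for all $x\in V$, let $u\in F^+$, and put $\|x\|:=T(x,x)\boxtimes u$ for $x\in V$. Then for all $x,y\in V$ the infimum $\inf_{\lambda\in\mathbb{R}\setminus\{0\}}\{|\lambda|^{-1}\|\lambda x-y\|^2\}$ exists in $F$, and \[ \|x+y\|^2\;\le\;(\|x\|+\|y\|)^2-\inf_{\lambda\in\mathbb{R}\setminus\{0\}}\{|\lambda|^{-1}\|\lambda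 x-y\|^2\}\;\le\;(\|x\|+\|y\|)^2 . \] Moreover, the first inequality is an equality if and only if $T(x,y)u\in F^+$. -/

import Mathlib

namespace VectorSeminorm

section Lattice

variable (F : Type*) [Lattice F] [AddCommGroup F] [Module ℝ F]

/-- A vector lattice is Archimedean if `inf {n⁻¹ u : n = 1, 2, 3, …} = 0` for all `u ≥ 0`. -/
def IsArchimedeanLattice : Prop :=
  ∀ u : F, 0 ≤ u → IsGLB ((fun n : ℕ => (n : ℝ)⁻¹ • u) '' Set.Ici 1) 0

variable {F}

/-- The set `{θ u + θ⁻¹ v : θ ∈ (0, ∞)}`. -/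
def geomMeanSet (u v : F) : Set F :=
  (fun θ : ℝ => θ • u + θ⁻¹ • v) '' Set.Ioi 0

variable (F)

/-- A vector lattice is geometric mean closed if `inf {θ u + θ⁻¹ v : θ ∈ (0, ∞)}` exists for all
`u, v ≥ 0`. -/
def IsGeometricMeanClosed : Prop :=
  ∀ u v : F, 0 ≤ u → 0 ≤ v → ∃ g : F, IsGLB (geomMeanSet u v) g

variable {F}

open Classical in
/-- The geometric mean `u ⊠ v = 2⁻¹ inf {θ u + θ⁻¹ v : θ ∈ (0, ∞)}`. The value is meaningful
whenever the infimum exists, hence for all `u, v ≥ 0` in a geometric mean closed vector lattice. -/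
noncomputable def geomMean (u v : F) : F :=
  (2 : ℝ)⁻¹ • (if h : ∃ g : F, IsGLB (geomMeanSet u v) g then h.choose else 0)

theorem IsGeometricMeanClosed.isGLB (hF : IsGeometricMeanClosed F) {u v : F}
    (hu : 0 ≤ u) (hv : 0 ≤ v) : IsGLB (geomMeanSet u v) ((2 : ℝ) • geomMean u v) := by
  have h := hF u v hu hv
  simpa [geomMean, h] using h.choose_spec

end Lattice

/-- The axioms which turn a vector lattice with an associative ring multiplication into an
`f`-algebra. -/
structure IsFAlgebra (F : Type*) [Lattice F] [NonUnitalRing F] : Prop where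
  mul_nonneg : ∀ x y : F, 0 ≤ x → 0 ≤ y → 0 ≤ x * y
  inf_mul : ∀ x y : F, x ⊓ y = 0 → ∀ z : F, 0 ≤ z → (x * z) ⊓ y = 0 ∧ x ⊓ (y * z) = 0

/-- A ring is semiprime (here: free of nilpotents) if no power `aⁿ⁺¹ = a a ⋯ a` of a nonzero
element vanishes. The power is written as an iterated product since there is no unit. -/
def IsSemiprime (F : Type*) [NonUnitalRing F] : Prop :=
  ∀ (a : F) (n : ℕ), (fun b : F => b * a)^[n] a = 0 → a = 0

section SemiInner

variable {V F : Type*} [AddCommGroup V] [Module ℝ V] [Lattice F] [AddCommGroup F] [Module ℝ F]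

/-- A vector semi-inner product is a symmetric, positive semidefinite bilinear map with values in
an ordered vector space. -/
structure IsVectorSemiInner (T : V →ₗ[ℝ] V →ₗ[ℝ] F) : Prop where
  symm : ∀ x y : V, T x y = T y x
  nonneg : ∀ x : V, 0 ≤ T x x

/-- The map `‖x‖ = T(x, x) ⊠ u`. -/
noncomputable def vnorm (T : V →ₗ[ℝ] V →ₗ[ℝ] F) (u : F) (x : V) : F :=
  geomMean (T x x) u

end SemiInner

end VectorSeminorm

open VectorSeminorm

/-!
The identity `‖z‖² = T(z, z) u` reduces the theorem to the algebra of `A = ‖x‖²`, `B = ‖y‖²` and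
`C = T(x, y) u`. Indeed `|l|⁻¹ ‖l x - y‖² = |l| A + |l|⁻¹ B ∓ 2 C`, with the sign opposite to that
of `l`; the infimum over each sign of `l` is `2 ‖x‖ ‖y‖ ∓ 2 C`, so that the infimum over `l ≠ 0`
is `m = 2 ‖x‖ ‖y‖ - 2 |C|`. Hence `(‖x‖ + ‖y‖)² - m - ‖x + y‖² = 2 (|C| - C)`, which is nonnegative
and vanishes exactly if `C ≥ 0`; and `m ≥ 0`, being an infimum of multiples of squares.

What this uses about an Archimedean semiprime `f`-algebra is proved below: multiplication is real
bilinear (`IsFAlgebra.isScalarTower`, `IsFAlgebra.smulCommClass`) and commutative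
(`IsFAlgebra.mul_comm`), `(a ⊠ b)² = a b` (`IsFAlgebra.geomMean_mul_self`), and
`inf {θ p² + θ⁻¹ q²} = 2 p q` (`IsFAlgebra.isGLB_geomMeanSet_mul_self`).

The tool is a representation by total preorders: an element is nonnegative as soon as it is
nonnegative for each preorder in a class of total ones that are compatible with the structure
(`IsFAlgebra.nonneg_of_forall_isTotalCone`). For a single total preorder one may distinguish cases
and divide with remainder; since the preorders themselves need not be Archimedean, each argument
proves an estimate with an error that is independent of the preorder, and the Archimedean property
of `F` then removes the error.

The axioms of an `f`-algebra are about multiplication on the right only. Thus commutativity is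
first proved for right multiplications, that is as `x b c = x c b`, and semiprimeness turns this
into `b c = c b`.
-/

namespace VectorSeminorm

/-! ### Archimedean vector lattices -/

section Archimedean

variable {F : Type*} [Lattice F] [AddCommGroup F] [Module ℝ F] [IsOrderedAddMonoid F]
  [IsOrderedModule ℝ F]

omit [IsOrderedAddMonoid F] in
theorem IsArchimedeanLattice.nonpos (hA : IsArchimedeanLattice F) {x w : F} (hw : 0 ≤ w)
    (h : ∀ n : ℕ, 1 ≤ n → (n : ℝ) • x ≤ w) : x ≤ 0 := by
  refine (hA w hw).2 ?_
  rintro _ ⟨n, hn, rfl⟩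
  have hn0 : (0 : ℝ) < n := by exact_mod_cast (show 0 < n from hn)
  have := smul_le_smul_of_nonneg_left (h n hn) (inv_nonneg.2 hn0.le)
  rwa [inv_smul_smul₀ hn0.ne'] at this

/-- A positive additive map on an Archimedean vector lattice is automatically real linear: it is
`ℕ`-linear, and the real scalars are squeezed between multiples of `1 / n`. -/
theorem IsArchimedeanLattice.map_smul_of_nonneg (hA : IsArchimedeanLattice F) (f : F →+ F)
    (hf : ∀ x, 0 ≤ x → 0 ≤ f x) (r : ℝ) (x : F) : f (r • x) = r • f x := by
  have mono : ∀ {a b : F}, a ≤ b → f a ≤ f b := fun {a b} hab => by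
    have := hf (b - a) (sub_nonneg.2 hab)
    rwa [map_sub, sub_nonneg] at this
  have map_nat : ∀ (k : ℕ) (z : F), f ((k : ℝ) • z) = (k : ℝ) • f z := fun k z => by
    rw [Nat.cast_smul_eq_nsmul, Nat.cast_smul_eq_nsmul, map_nsmul]
  have pos : ∀ (s : ℝ) (z : F), 0 ≤ s → 0 ≤ z → f (s • z) = s • f z := by
    intro s z hs hz
    have bounds : ∀ n : ℕ, ∃ k : ℕ, (k : ℝ) • f z ≤ (n : ℝ) • f (s • z) ∧
        (n : ℝ) • f (s • z) ≤ ((k : ℝ) + 1) • f z ∧ (k : ℝ) ≤ n * s ∧ n * s ≤ (k : ℝ) + 1 := by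
      intro n
      have h0 : (0 : ℝ) ≤ n * s := by positivity
      have h1 := Nat.floor_le h0
      have h2 := (Nat.lt_floor_add_one ((n : ℝ) * s)).le
      refine ⟨⌊(n : ℝ) * s⌋₊, ?_, ?_, h1, h2⟩
      · rw [← map_nat, ← map_nat, smul_smul]
        exact mono (smul_le_smul_of_nonneg_right h1 hz)
      · have : ((⌊(n : ℝ) * s⌋₊ : ℝ) + 1) = ((⌊(n : ℝ) * s⌋₊ + 1 : ℕ) : ℝ) := by push_cast; rfl
        rw [this, ← map_nat, ← map_nat, smul_smul, ← this]
        exact mono (smul_le_smul_of_nonneg_right h2 hz)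
    have hfz := hf z hz
    apply le_antisymm
    · rw [← sub_nonpos]
      refine hA.nonpos hfz fun n _ => ?_
      obtain ⟨k, -, h2, h3, -⟩ := bounds n
      have h4 := smul_le_smul_of_nonneg_right h3 hfz
      calc (n : ℝ) • (f (s • z) - s • f z) = (n : ℝ) • f (s • z) - (n * s) • f z := by module
        _ ≤ ((k : ℝ) + 1) • f z - (k : ℝ) • f z := sub_le_sub h2 h4
        _ = f z := by module
    · rw [← sub_nonpos]
      refine hA.nonpos hfz fun n _ => ?_
      obtain ⟨k, h1, -, -, h3⟩ := bounds n
      have h4 := smul_le_smul_of_nonneg_right h3 hfz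
      calc (n : ℝ) • (s • f z - f (s • z)) = (n * s) • f z - (n : ℝ) • f (s • z) := by module
        _ ≤ ((k : ℝ) + 1) • f z - (k : ℝ) • f z := sub_le_sub h4 h1
        _ = f z := by module
  have pos' : ∀ (z : F), 0 ≤ z → f (r • z) = r • f z := by
    intro z hz
    rcases le_total 0 r with hr | hr
    · exact pos r z hr hz
    · have := pos (-r) z (by linarith) hz
      rw [neg_smul, neg_smul, map_neg] at this
      exact neg_injective this
  rw [← posPart_sub_negPart x, smul_sub, map_sub, map_sub, smul_sub,
    pos' _ (posPart_nonneg x), pos' _ (negPart_nonneg x)]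

end Archimedean

section FAlgebraScalars

variable {F : Type*} [Lattice F] [NonUnitalRing F] [Module ℝ F] [IsOrderedAddMonoid F]
  [IsOrderedModule ℝ F]

theorem IsFAlgebra.isScalarTower (h : IsFAlgebra F) (hA : IsArchimedeanLattice F) :
    IsScalarTower ℝ F F := by
  have pos : ∀ (r : ℝ) (a c : F), 0 ≤ c → (r • a) * c = r • (a * c) := fun r a c hc =>
    hA.map_smul_of_nonneg (AddMonoidHom.mulRight c) (fun x hx => h.mul_nonneg x c hx hc) r a
  refine ⟨fun r a c => ?_⟩
  rw [smul_eq_mul, smul_eq_mul, ← posPart_sub_negPart c, mul_sub, mul_sub, smul_sub,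
    pos _ _ _ (posPart_nonneg c), pos _ _ _ (negPart_nonneg c)]

theorem IsFAlgebra.smulCommClass (h : IsFAlgebra F) (hA : IsArchimedeanLattice F) :
    SMulCommClass ℝ F F := by
  have pos : ∀ (r : ℝ) (a c : F), 0 ≤ c → c * (r • a) = r • (c * a) := fun r a c hc =>
    hA.map_smul_of_nonneg (AddMonoidHom.mulLeft c) (fun x hx => h.mul_nonneg c x hc hx) r a
  refine ⟨fun r c a => ?_⟩
  rw [smul_eq_mul, smul_eq_mul, ← posPart_sub_negPart c, sub_mul, sub_mul, smul_sub,
    pos _ _ _ (posPart_nonneg c), pos _ _ _ (negPart_nonneg c)]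

end FAlgebraScalars

/-! ### Total cones and the reduction to them -/

section Cones

variable {F : Type*} [Lattice F] [NonUnitalRing F]

/-- The positive part of an order ideal of `F` which is invariant under multiplication on the right
by positive elements. -/
structure IsRightIdealCone (P : Set F) : Prop where
  zero_mem : 0 ∈ P
  nonneg : ∀ x ∈ P, 0 ≤ x
  add_mem : ∀ x ∈ P, ∀ y ∈ P, x + y ∈ P
  mem_of_le : ∀ x y, 0 ≤ x → x ≤ y → y ∈ P → x ∈ P
  mul_mem : ∀ x ∈ P, ∀ c, 0 ≤ c → x * c ∈ P

variable [IsOrderedAddMonoid F]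

theorem add_inf_eq_zero {x y z : F} (hx : 0 ≤ x) (hy : 0 ≤ y) (hz : 0 ≤ z)
    (hxz : x ⊓ z = 0) (hyz : y ⊓ z = 0) : (x + y) ⊓ z = 0 := by
  refine le_antisymm ?_ (le_inf (add_nonneg hx hy) hz)
  have h1 : (x + y) ⊓ z - y ≤ x ⊓ z :=
    le_inf (sub_le_iff_le_add.2 inf_le_left)
      ((sub_le_self _ hy).trans inf_le_right)
  rw [hxz, sub_nonpos] at h1
  calc (x + y) ⊓ z ≤ y ⊓ z := le_inf h1 inf_le_right
    _ = 0 := hyz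

/-- The positive elements disjoint from all elements of `S`. -/
def polar (S : Set F) : Set F := {z | 0 ≤ z ∧ ∀ w ∈ S, z ⊓ w = 0}

theorem IsFAlgebra.isRightIdealCone_polar (h : IsFAlgebra F) {S : Set F} (hS : ∀ w ∈ S, 0 ≤ w) :
    IsRightIdealCone (polar S) where
  zero_mem := ⟨le_rfl, fun w hw => inf_eq_left.2 (hS w hw)⟩
  nonneg _ hx := hx.1
  add_mem _ hx _ hy := ⟨add_nonneg hx.1 hy.1, fun w hw =>
    add_inf_eq_zero hx.1 hy.1 (hS w hw) (hx.2 w hw) (hy.2 w hw)⟩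
  mem_of_le _ _ hx hxy hy := ⟨hx, fun w hw =>
    le_antisymm ((inf_le_inf_right w hxy).trans (hy.2 w hw).le) (le_inf hx (hS w hw))⟩
  mul_mem x hx c hc := ⟨h.mul_nonneg x c hx.1 hc, fun w hw =>
    (h.inf_mul x w (hx.2 w hw) c hc).1⟩

theorem IsFAlgebra.mul_le_mul_right (h : IsFAlgebra F) {a b c : F} (hc : 0 ≤ c) (hab : a ≤ b) :
    a * c ≤ b * c := by
  have := h.mul_nonneg (b - a) c (sub_nonneg.2 hab) hc
  rwa [sub_mul, sub_nonneg] at this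

theorem IsFAlgebra.isRightIdealCone_sup (h : IsFAlgebra F) {P A : Set F} (hP : IsRightIdealCone P)
    (hA : IsRightIdealCone A) :
    IsRightIdealCone {z : F | 0 ≤ z ∧ ∃ p ∈ P, ∃ a ∈ A, z ≤ p + a} where
  zero_mem := ⟨le_rfl, 0, hP.zero_mem, 0, hA.zero_mem, by simp⟩
  nonneg _ hx := hx.1
  add_mem := by
    rintro x ⟨hx, p, hp, a, ha, hxpa⟩ y ⟨hy, q, hq, b, hb, hyqb⟩
    refine ⟨add_nonneg hx hy, p + q, hP.add_mem p hp q hq, a + b, hA.add_mem a ha b hb, ?_⟩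
    calc x + y ≤ (p + a) + (q + b) := add_le_add hxpa hyqb
      _ = p + q + (a + b) := by abel
  mem_of_le := by
    rintro x y hx hxy ⟨-, p, hp, a, ha, hypa⟩
    exact ⟨hx, p, hp, a, ha, hxy.trans hypa⟩
  mul_mem := by
    rintro x ⟨hx, p, hp, a, ha, hxpa⟩ c hc
    refine ⟨h.mul_nonneg x c hx hc, p * c, hP.mul_mem p hp c hc, a * c, hA.mul_mem a ha c hc, ?_⟩
    rw [← add_mul]
    exact h.mul_le_mul_right hc hxpa

/-- An ideal cone that is maximal among those avoiding a positive element `g` is prime. If `x` and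
`y` are disjoint, then `g` cannot be dominated both modulo the polar of `y` and modulo its
bipolar, because these are disjoint; so one of them is absorbed. -/
theorem IsFAlgebra.exists_prime (h : IsFAlgebra F) {g : F} (hg0 : 0 ≤ g) (hg : g ≠ 0) :
    ∃ P : Set F, IsRightIdealCone P ∧ g ∉ P ∧ ∀ x y : F, x ⊓ y = 0 → x ∈ P ∨ y ∈ P := by
  obtain ⟨P, -, hmax⟩ := zorn_subset_nonempty {P : Set F | IsRightIdealCone P ∧ g ∉ P}
    (by
      intro C hC hchain ⟨P₀, hP₀⟩
      refine ⟨⋃₀ C, ⟨⟨⟨P₀, hP₀, (hC hP₀).1.zero_mem⟩, ?_, ?_, ?_, ?_⟩, ?_⟩,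
        fun s hs => Set.subset_sUnion_of_mem hs⟩
      · rintro x ⟨P, hP, hx⟩
        exact (hC hP).1.nonneg x hx
      · rintro x ⟨P, hP, hx⟩ y ⟨R, hR, hy⟩
        rcases hchain.total hP hR with hle | hle
        · exact ⟨R, hR, (hC hR).1.add_mem x (hle hx) y hy⟩
        · exact ⟨P, hP, (hC hP).1.add_mem x hx y (hle hy)⟩
      · rintro x y hx hxy ⟨P, hP, hy⟩
        exact ⟨P, hP, (hC hP).1.mem_of_le x y hx hxy hy⟩
      · rintro x ⟨P, hP, hx⟩ c hc
        exact ⟨P, hP, (hC hP).1.mul_mem x hx c hc⟩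
      · rintro ⟨P, hP, hgP⟩
        exact (hC hP).2 hgP)
    {0} ⟨⟨rfl, by simp, by simp, fun x y hx hxy hy => le_antisymm (hxy.trans hy.le) hx,
      by simp⟩, hg⟩
  have hP : IsRightIdealCone P := hmax.prop.1
  refine ⟨P, hP, hmax.prop.2, fun x y hxy => ?_⟩
  have hx : 0 ≤ x := hxy ▸ inf_le_left
  have hy : 0 ≤ y := hxy ▸ inf_le_right
  set A : Set F := polar {y} with hAdef
  set B : Set F := polar A with hBdef
  have hA : IsRightIdealCone A := h.isRightIdealCone_polar (by simpa using hy)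
  have hB : IsRightIdealCone B := h.isRightIdealCone_polar hA.nonneg
  have hxA : x ∈ A := ⟨hx, by simpa using hxy⟩
  have hyB : y ∈ B := ⟨hy, fun w hw => by rw [inf_comm]; exact hw.2 y rfl⟩
  have absorb : ∀ A : Set F, IsRightIdealCone A → (∀ p ∈ P, ∀ a ∈ A, ¬ g ≤ p + a) → A ⊆ P := by
    intro A hA hgA a ha
    have hle : P ⊆ {z : F | 0 ≤ z ∧ ∃ p ∈ P, ∃ a ∈ A, z ≤ p + a} := fun p hp =>
      ⟨hP.nonneg p hp, p, hp, 0, hA.zero_mem, by simp⟩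
    refine hmax.le_of_ge ⟨h.isRightIdealCone_sup hP hA, ?_⟩ hle
      ⟨hA.nonneg a ha, 0, hP.zero_mem, a, ha, by simp⟩
    rintro ⟨-, p, hp, a, ha, hle⟩
    exact hgA p hp a ha hle
  by_cases h1 : ∀ p ∈ P, ∀ a ∈ A, ¬ g ≤ p + a
  · exact Or.inl (absorb A hA h1 hxA)
  by_cases h2 : ∀ p ∈ P, ∀ a ∈ B, ¬ g ≤ p + a
  · exact Or.inr (absorb B hB h2 hyB)
  push Not at h1 h2
  obtain ⟨p, hp, a, ha, hpa⟩ := h1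
  obtain ⟨q, hq, b, hb, hqb⟩ := h2
  refine absurd (hP.mem_of_le g (p + q) hg0 ?_ (hP.add_mem p hp q hq)) hmax.prop.2
  have hab : a ⊓ b = 0 := by rw [inf_comm]; exact hb.2 a ha
  have h3 : g - (p + q) ≤ a ⊓ b := by
    refine le_inf ?_ ?_ <;> rw [sub_le_iff_le_add]
    · calc g ≤ p + a := hpa
        _ ≤ p + a + q := le_add_of_nonneg_right (hP.nonneg q hq)
        _ = a + (p + q) := by abel
    · calc g ≤ q + b := hqb
        _ ≤ q + b + p := le_add_of_nonneg_right (hP.nonneg p hp)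
        _ = b + (p + q) := by abel
  rwa [hab, sub_nonpos] at h3

variable [Module ℝ F]

/-- The cone of nonnegative elements for a total preorder on `F` that extends the given order, is
compatible with the linear structure and with right multiplication by positive elements, and has a
lattice homomorphism as its quotient map. Membership `y - x ∈ Q` stands for `x ≤ y` modulo the
order ideal `Q ∩ -Q`. -/
structure IsTotalCone (Q : Set F) : Prop where
  of_nonneg : ∀ {x}, 0 ≤ x → x ∈ Q
  add : ∀ {x y}, x ∈ Q → y ∈ Q → x + y ∈ Q
  smul : ∀ {r : ℝ} {x}, 0 ≤ r → x ∈ Q → r • x ∈ Q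
  mul_right : ∀ {x c}, x ∈ Q → 0 ≤ c → x * c ∈ Q
  total : ∀ x, x ∈ Q ∨ -x ∈ Q
  neg_posPart : ∀ {x}, -x ∈ Q → -x⁺ ∈ Q

/-- The total cones cut out the positive cone of `F`. They replace the representation of `F` as a
subdirect product of totally ordered right modules. -/
theorem IsFAlgebra.nonneg_of_forall_isTotalCone [IsOrderedModule ℝ F] (h : IsFAlgebra F) {g : F}
    (hg : ∀ Q : Set F, IsTotalCone Q → g ∈ Q) : 0 ≤ g := by
  by_contra hneg
  have hg' : g⁻ ≠ 0 := by rwa [Ne, negPart_eq_zero]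
  obtain ⟨P, hP, hgP, hprime⟩ := h.exists_prime (negPart_nonneg g) hg'
  refine hgP (hg {x | x⁻ ∈ P} ⟨?_, ?_, ?_, ?_, ?_, ?_⟩)
  · intro x hx
    have : x⁻ = 0 := negPart_eq_zero.2 hx
    simpa [this] using hP.zero_mem
  · intro x y hx hy
    refine hP.mem_of_le _ _ (negPart_nonneg _) ?_ (hP.add_mem _ hx _ hy)
    rw [negPart_def (x + y)]
    refine sup_le ?_ (add_nonneg (negPart_nonneg x) (negPart_nonneg y))
    rw [neg_add]
    exact add_le_add (neg_le_negPart x) (neg_le_negPart y)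
  · intro r x hr hx
    have nat : ∀ n : ℕ, n • x⁻ ∈ P := fun n => by
      induction n with
      | zero => simpa using hP.zero_mem
      | succ n ih => rw [succ_nsmul]; exact hP.add_mem _ ih _ hx
    refine hP.mem_of_le _ _ (negPart_nonneg _) ?_ (nat ⌈r⌉₊)
    have h1 : (r • x)⁻ ≤ r • x⁻ := by
      rw [negPart_def (r • x)]
      refine sup_le ?_ (smul_nonneg hr (negPart_nonneg x))
      rw [← smul_neg]
      exact smul_le_smul_of_nonneg_left (neg_le_negPart x) hr
    rw [← Nat.cast_smul_eq_nsmul ℝ]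
    exact h1.trans (smul_le_smul_of_nonneg_right (Nat.le_ceil r) (negPart_nonneg x))
  · intro x c hx hc
    refine hP.mem_of_le _ _ (negPart_nonneg _) ?_ (hP.mul_mem _ hx c hc)
    rw [negPart_def (x * c)]
    refine sup_le ?_ (h.mul_nonneg _ _ (negPart_nonneg x) hc)
    rw [← neg_mul]
    exact h.mul_le_mul_right hc (neg_le_negPart x)
  · intro x
    have := hprime x⁻ x⁺ (by rw [inf_comm]; exact posPart_inf_negPart_eq_zero x)
    simpa [negPart_neg] using this
  · intro x hx
    have : x⁺ ∈ P := by simpa [negPart_neg] using hx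
    simpa [negPart_neg, posPart_eq_self.2 (posPart_nonneg x)] using this

end Cones
/-! ### Arithmetic with total cones -/

theorem exists_lt_and_not_succ {p : ℕ → Prop} {N : ℕ} (h0 : p 0) (hN : ¬ p N) :
    ∃ k < N, p k ∧ ¬ p (k + 1) := by
  by_contra! hcon
  have : ∀ k ≤ N, p k := fun k => by
    induction k with
    | zero => exact fun _ => h0
    | succ k ih => exact fun hk => hcon k hk (ih (Nat.le_of_succ_le hk))
  exact hN (this N le_rfl)

theorem mem_of_mem_of_eq {F : Type*} {Q : Set F} {x y : F} (hx : x ∈ Q) (h : x = y) : y ∈ Q :=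
  h ▸ hx

section Cones

variable {F : Type*} [Lattice F] [NonUnitalRing F] [IsOrderedAddMonoid F] [Module ℝ F]

namespace IsTotalCone

variable {Q : Set F}

omit [IsOrderedAddMonoid F] in
/-- Division with remainder modulo a total cone: if `0 ≤ x ≤ y`, then `n x` lies between two
consecutive multiples of `y`. -/
theorem exists_nat_smul (hQ : IsTotalCone Q) {x y : F} (hx : x ∈ Q) (hxy : y - x ∈ Q) (n : ℕ) :
    ∃ k : ℕ, (n : ℝ) • x - (k : ℝ) • y ∈ Q ∧ ((k : ℝ) + 1) • y - (n : ℝ) • x ∈ Q := by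
  have hy : y ∈ Q := mem_of_mem_of_eq (hQ.add hx hxy) (by abel)
  by_cases hn : (n : ℝ) • x - (n : ℝ) • y ∈ Q
  · exact ⟨n, hn, mem_of_mem_of_eq (hQ.add (hQ.smul n.cast_nonneg hxy) hy) (by module)⟩
  · obtain ⟨k, -, hk, hk'⟩ := exists_lt_and_not_succ
      (p := fun k : ℕ => (n : ℝ) • x - (k : ℝ) • y ∈ Q) (N := n)
      (mem_of_mem_of_eq (hQ.smul n.cast_nonneg hx) (by simp)) hn
    refine ⟨k, hk, mem_of_mem_of_eq ((hQ.total _).resolve_left hk') ?_⟩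
    push_cast
    module

theorem sub_posPart (hQ : IsTotalCone Q) {u v : F} (hv : v ∈ Q) (huv : v - u ∈ Q) :
    v - u⁺ ∈ Q := by
  rcases hQ.total u with hu | hu
  · have h1 : -(-u)⁺ ∈ Q := hQ.neg_posPart (by simpa using hu)
    rw [posPart_neg] at h1
    refine mem_of_mem_of_eq (hQ.add huv h1) ?_
    have := posPart_sub_negPart u
    nth_rewrite 1 [← this]
    abel
  · exact mem_of_mem_of_eq (hQ.add hv (hQ.neg_posPart hu)) (by abel)

end IsTotalCone

/-! ### Commutativity -/

variable [IsOrderedModule ℝ F]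

/-- Right multiplication by `d` has a sign modulo a total cone: it cannot be positive at `x` and
negative at `y`. The Archimedean property enters because for `x ≤ y` the element `n x` agrees with a
multiple of `y` up to a remainder below `y`, so `n (x d)` exceeds a multiple of `y d` by
at most `y |d|`. -/
theorem IsFAlgebra.posPart_inf_negPart_mul (h : IsFAlgebra F) (hA : IsArchimedeanLattice F)
    {x y : F} (hx : 0 ≤ x) (hy : 0 ≤ y) (d : F) : (x * d)⁺ ⊓ (y * d)⁻ = 0 := by
  have := h.isScalarTower hA
  have key : ∀ {Q : Set F}, IsTotalCone Q → ∀ (n : ℕ), 1 ≤ n → ∀ {x y : F}, 0 ≤ x → 0 ≤ y →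
      y - x ∈ Q → ∀ d : F, (x + y) * |d| - (n : ℝ) • ((x * d)⁺ ⊓ (y * d)⁻) ∈ Q := by
    intro Q hQ n hn x y hx hy hxy d
    have hn0 : (0 : ℝ) < n := by exact_mod_cast hn
    have he : 0 ≤ |d| := abs_nonneg d
    have hxe := h.mul_nonneg x _ hx he
    have hye := h.mul_nonneg y _ hy he
    obtain ⟨k, hk, hk'⟩ := hQ.exists_nat_smul (hQ.of_nonneg hx) hxy n
    rcases hQ.total (y * d) with hyd | hyd
    · have h1 : -(-(y * d))⁺ ∈ Q := hQ.neg_posPart (by simpa using hyd)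
      rw [posPart_neg] at h1
      have h2 : (y * d)⁻ - (x * d)⁺ ⊓ (y * d)⁻ ∈ Q := hQ.of_nonneg (sub_nonneg.2 inf_le_right)
      refine mem_of_mem_of_eq (hQ.add (hQ.add (hQ.smul hn0.le (hQ.add h1 h2))
        (hQ.of_nonneg hxe)) (hQ.of_nonneg hye)) ?_
      rw [add_mul]
      module
    · have h1 : ((n : ℝ) • x - (k : ℝ) • y) * (|d| - d) ∈ Q :=
        hQ.mul_right hk (sub_nonneg.2 (le_abs_self d))
      have h2 : (((k : ℝ) + 1) • y - (n : ℝ) • x) * |d| ∈ Q := hQ.mul_right hk' he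
      have h3 : (n : ℝ)⁻¹ • (y * |d|) - x * d ∈ Q := by
        refine mem_of_mem_of_eq (hQ.smul (inv_nonneg.2 hn0.le)
          (hQ.add (hQ.add h1 h2) (hQ.smul k.cast_nonneg hyd))) ?_
        simp only [sub_mul, mul_sub, smul_mul_assoc, smul_sub, smul_add, smul_neg, smul_smul,
          inv_mul_cancel₀ hn0.ne', one_smul]
        module
      have h4 := hQ.sub_posPart (hQ.smul (inv_nonneg.2 hn0.le) (hQ.of_nonneg hye)) h3
      have h5 : (x * d)⁺ - (x * d)⁺ ⊓ (y * d)⁻ ∈ Q := hQ.of_nonneg (sub_nonneg.2 inf_le_left)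
      refine mem_of_mem_of_eq (hQ.add (hQ.smul hn0.le (hQ.add h4 h5))
        (hQ.of_nonneg hxe)) ?_
      simp only [add_mul, smul_sub, smul_add, smul_smul, mul_inv_cancel₀ hn0.ne', one_smul]
      module
  refine le_antisymm (hA.nonpos (h.mul_nonneg _ _ (add_nonneg hx hy) (abs_nonneg d))
    fun n hn => ?_) (le_inf (posPart_nonneg _) (negPart_nonneg _))
  rw [← sub_nonneg]
  refine h.nonneg_of_forall_isTotalCone fun Q hQ => ?_
  rcases hQ.total (y - x) with hxy | hxy
  · exact key hQ n hn hx hy hxy d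
  · have := key hQ n hn hy hx (by simpa using hxy) (-d)
    simpa [posPart_neg, negPart_neg, inf_comm, add_comm] using this

theorem IsTotalCone.neg_mul_mem_or_mul_mem {Q : Set F} (hQ : IsTotalCone Q) (h : IsFAlgebra F)
    (hA : IsArchimedeanLattice F) {x y : F} (hx : 0 ≤ x) (hy : 0 ≤ y) (d : F) :
    -(x * d) ∈ Q ∨ y * d ∈ Q := by
  have h0 := h.posPart_inf_negPart_mul hA hx hy d
  set a := (x * d)⁺
  set b := (y * d)⁻
  -- Disjoint elements cannot both be positive modulo `Q`.
  have hab : -a ∈ Q ∨ -b ∈ Q := by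
    have e1 : (a - b)⁺ = a := by
      rw [posPart_def, ← sub_self b, ← sup_sub, eq_comm, eq_sub_iff_add_eq, ← inf_add_sup a b,
        h0, zero_add]
    have e2 : (b - a)⁺ = b := by
      rw [posPart_def, ← sub_self a, ← sup_sub, eq_comm, eq_sub_iff_add_eq, ← inf_add_sup b a,
        inf_comm, h0, zero_add]
    rcases hQ.total (a - b) with h1 | h1
    · right
      rw [← e2]
      exact hQ.neg_posPart (by simpa using h1)
    · left
      rw [← e1]
      exact hQ.neg_posPart h1
  refine hab.imp (fun h1 => ?_) fun h1 => ?_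
  · exact mem_of_mem_of_eq (hQ.add h1 (hQ.of_nonneg (sub_nonneg.2 (le_posPart (x * d))))) (by abel)
  · exact mem_of_mem_of_eq (hQ.add h1 (hQ.of_nonneg
      (sub_nonneg.2 (neg_le_negPart (y * d))))) (by abel)

/-- Right multiplications commute. Modulo a total cone, `n (x b) = k (x c) + r` with
`0 ≤ r ≤ x c`; as right multiplications by `n b - (k - 1) c` and `n c - (k + 2) b` have a sign, the
same `k` is correct at `x c` up to a bounded error, which is independent of `n`. -/
theorem IsFAlgebra.mul_right_comm_of_nonneg (h : IsFAlgebra F) (hA : IsArchimedeanLattice F)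
    {x b c : F} (hx : 0 ≤ x) (hb : 0 ≤ b) (hc : 0 ≤ c) : x * b * c = x * c * b := by
  have := h.isScalarTower hA
  have := h.smulCommClass hA
  have key : ∀ {b c : F}, 0 ≤ b → 0 ≤ c → x * b * c - x * c * b ≤ 0 := by
    intro b c hb hc
    have hxb := h.mul_nonneg x b hx hb
    have hxc := h.mul_nonneg x c hx hc
    have hxbb := h.mul_nonneg _ b hxb hb
    have hxcb := h.mul_nonneg _ b hxc hb
    have hxcc := h.mul_nonneg _ c hxc hc
    refine hA.nonpos (w := (2 : ℝ) • (x * b * b + x * c * c))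
      (smul_nonneg zero_le_two (add_nonneg hxbb hxcc)) fun n _ => ?_
    rw [← sub_nonneg]
    refine h.nonneg_of_forall_isTotalCone fun Q hQ => ?_
    have hrest : (2 : ℝ) • (x * b * b + x * c * c) ∈ Q :=
      hQ.of_nonneg (smul_nonneg zero_le_two (add_nonneg hxbb hxcc))
    -- The case where `x b` vanishes modulo `Q`.
    have degenerate : -(x * b) ∈ Q →
        (2 : ℝ) • (x * b * b + x * c * c) - (n : ℝ) • (x * b * c - x * c * b) ∈ Q := fun h0 =>
      mem_of_mem_of_eq (hQ.add hrest (hQ.smul n.cast_nonneg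
        (hQ.add (hQ.mul_right h0 hc) (hQ.of_nonneg hxcb)))) (by rw [neg_mul]; module)
    rcases hQ.total (x * c - x * b) with hle | hle
    · obtain ⟨k, hk, hk'⟩ := hQ.exists_nat_smul (hQ.of_nonneg hxb) hle n
      have hkc := hQ.mul_right hk' hc
      rcases hQ.neg_mul_mem_or_mul_mem h hA hx hxc ((n : ℝ) • b - ((k : ℝ) - 1) • c) with h1 | h1
      · refine degenerate (mem_of_mem_of_eq (hQ.add (hQ.add hk h1) hle) ?_)
        simp only [mul_sub, mul_smul_comm]
        module
      · refine mem_of_mem_of_eq (hQ.add (hQ.add hkc h1)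
          (hQ.smul zero_le_two (hQ.of_nonneg hxbb))) ?_
        simp only [sub_mul, mul_sub, mul_smul_comm, smul_mul_assoc]
        module
    · rw [neg_sub] at hle
      obtain ⟨k, hk, hk'⟩ := hQ.exists_nat_smul (hQ.of_nonneg hxc) hle n
      have hkb := hQ.mul_right hk hb
      rcases hQ.neg_mul_mem_or_mul_mem h hA hxb hx ((n : ℝ) • c - ((k : ℝ) + 2) • b) with h1 | h1
      · refine mem_of_mem_of_eq (hQ.add (hQ.add hkb h1)
          (hQ.smul zero_le_two (hQ.of_nonneg hxcc))) ?_
        simp only [sub_mul, mul_sub, mul_smul_comm, smul_mul_assoc]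
        module
      · refine degenerate (mem_of_mem_of_eq (hQ.add hk' h1) ?_)
        simp only [mul_sub, mul_smul_comm]
        module
  exact le_antisymm (sub_nonpos.1 (key hb hc)) (sub_nonpos.1 (key hc hb))

/-- In the semiprime case commutativity follows, since a commutator `w` satisfies `x w = 0` for
all `x`, in particular `w w = 0`. -/
theorem IsFAlgebra.mul_comm (h : IsFAlgebra F) (hA : IsArchimedeanLattice F)
    (hS : IsSemiprime F) (a b : F) : a * b = b * a := by
  have pos : ∀ {b c : F}, 0 ≤ b → 0 ≤ c → b * c = c * b := by
    intro b c hb hc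
    have hz : ∀ x, x * (b * c - c * b) = 0 := by
      intro x
      rw [← posPart_sub_negPart x, sub_mul, mul_sub, mul_sub, ← mul_assoc, ← mul_assoc,
        ← mul_assoc, ← mul_assoc, h.mul_right_comm_of_nonneg hA (posPart_nonneg x) hb hc,
        h.mul_right_comm_of_nonneg hA (negPart_nonneg x) hb hc]
      simp
    exact sub_eq_zero.1 (hS _ 1 (hz _))
  rw [← posPart_sub_negPart a, ← posPart_sub_negPart b, sub_mul, mul_sub, mul_sub, sub_mul, mul_sub,
    mul_sub, pos (posPart_nonneg a) (posPart_nonneg b), pos (posPart_nonneg a) (negPart_nonneg b),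
    pos (negPart_nonneg a) (posPart_nonneg b), pos (negPart_nonneg a) (negPart_nonneg b)]
  abel

omit [IsOrderedModule ℝ F] in
theorem IsTotalCone.mul {Q : Set F} (hQ : IsTotalCone Q) (h : IsFAlgebra F)
    (hcomm : ∀ a b : F, a * b = b * a) {x y : F} (hx : x ∈ Q) (hy : y ∈ Q) : x * y ∈ Q := by
  have neg : ∀ {z : F}, z ∈ Q → -z⁻ ∈ Q := fun {z} hz => by
    rw [← posPart_neg]
    exact hQ.neg_posPart (by simpa using hz)
  refine mem_of_mem_of_eq (hQ.add (hQ.add (hQ.add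
    (hQ.of_nonneg (h.mul_nonneg _ _ (posPart_nonneg x) (posPart_nonneg y)))
    (hQ.of_nonneg (h.mul_nonneg _ _ (negPart_nonneg x) (negPart_nonneg y))))
    (hQ.mul_right (neg hx) (posPart_nonneg y))) (hQ.mul_right (neg hy) (posPart_nonneg x))) ?_
  rw [neg_mul, neg_mul, hcomm y⁻ x⁺]
  nth_rewrite 5 [← posPart_sub_negPart x]
  nth_rewrite 5 [← posPart_sub_negPart y]
  rw [sub_mul, mul_sub, mul_sub]
  abel

theorem IsFAlgebra.mul_self_nonneg (h : IsFAlgebra F) (hcomm : ∀ a b : F, a * b = b * a) (x : F) :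
    0 ≤ x * x :=
  h.nonneg_of_forall_isTotalCone fun Q hQ => by
    rcases hQ.total x with hx | hx
    · exact hQ.mul h hcomm hx hx
    · simpa using hQ.mul h hcomm hx hx

/-! ### Infima and multiplication -/

/-- Multiplication by `c ≥ 0` preserves infima. The point is the estimate
`β c ≤ n β + n⁻¹ β c c` for `β ≥ 0`, which reduces a lower bound of `S c` to a lower bound of a
multiple of `S`, up to an error that is small uniformly below a fixed element of `S`. -/
theorem IsFAlgebra.isGLB_image_mul_right (h : IsFAlgebra F) (hA : IsArchimedeanLattice F)
    {S : Set F} (hS : S.Nonempty) {g c : F} (hg : IsGLB S g) (hc : 0 ≤ c) :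
    IsGLB ((fun a => a * c) '' S) (g * c) := by
  have := h.isScalarTower hA
  refine ⟨?_, fun w hw => ?_⟩
  · rintro _ ⟨a, ha, rfl⟩
    exact h.mul_le_mul_right hc (hg.1 ha)
  obtain ⟨a₀, ha₀⟩ := hS
  have h₀ : 0 ≤ a₀ - g := sub_nonneg.2 (hg.1 ha₀)
  have hE := h.mul_nonneg _ c (h.mul_nonneg _ c h₀ hc) hc
  rw [← sub_nonpos]
  refine hA.nonpos hE fun n hn => ?_
  have hn0 : (0 : ℝ) < n := by exact_mod_cast hn
  have hi : (0 : ℝ) ≤ (n : ℝ)⁻¹ := inv_nonneg.2 hn0.le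
  have est : ∀ a ∈ S, w - g * c ≤ (n : ℝ) • (a - g) + (n : ℝ)⁻¹ • ((a₀ - g) * c * c) := by
    intro a ha
    have hβ : 0 ≤ a - g := sub_nonneg.2 (hg.1 ha)
    have hw1 : 0 ≤ (a - g) * c - (w - g * c) := by
      rw [sub_mul, sub_sub_sub_cancel_right, sub_nonneg]
      exact hw ⟨a, ha, rfl⟩
    have hw2 : 0 ≤ (a₀ - g) * c - (w - g * c) := by
      rw [sub_mul, sub_sub_sub_cancel_right, sub_nonneg]
      exact hw ⟨a₀, ha₀, rfl⟩
    generalize a - g = β at *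
    generalize a₀ - g = β₀ at *
    generalize w - g * c = v at *
    rw [← sub_nonneg]
    refine h.nonneg_of_forall_isTotalCone fun Q hQ => ?_
    have hninv : (n : ℝ)⁻¹ * n = 1 := inv_mul_cancel₀ hn0.ne'
    rcases hQ.total (β₀ - β) with h1 | h1
    · rcases hQ.total (β * c - (n : ℝ) • β) with h2 | h2
      · refine mem_of_mem_of_eq (hQ.add (hQ.add (hQ.add (hQ.of_nonneg hw1)
          (hQ.smul hn0.le (hQ.of_nonneg hβ)))
          (hQ.smul hi (hQ.mul_right (hQ.mul_right h1 hc) hc)))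
          (hQ.smul hi (hQ.mul_right h2 hc))) ?_
        simp only [sub_mul, smul_mul_assoc, smul_sub, smul_smul, hninv, one_smul]
        abel
      · exact mem_of_mem_of_eq (hQ.add (hQ.add (hQ.of_nonneg hw1) h2)
          (hQ.smul hi (hQ.of_nonneg hE))) (by abel)
    · rcases hQ.total (β₀ * c - (n : ℝ) • β₀) with h2 | h2
      · refine mem_of_mem_of_eq (hQ.add (hQ.add (hQ.of_nonneg hw2)
          (hQ.smul hn0.le (hQ.of_nonneg hβ))) (hQ.smul hi (hQ.mul_right h2 hc))) ?_
        simp only [sub_mul, smul_mul_assoc, smul_sub, smul_smul, hninv, one_smul]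
        abel
      · refine mem_of_mem_of_eq (hQ.add (hQ.add (hQ.add (hQ.of_nonneg hw2) h2)
          (hQ.smul hn0.le h1)) (hQ.smul hi (hQ.of_nonneg hE))) ?_
        module
  have hlow : (n : ℝ)⁻¹ • (w - g * c - (n : ℝ)⁻¹ • ((a₀ - g) * c * c)) + g ≤ g := by
    refine hg.2 fun a ha => ?_
    rw [← le_sub_iff_add_le]
    have := smul_le_smul_of_nonneg_left (sub_le_iff_le_add.2 (est a ha)) hi
    rwa [inv_smul_smul₀ hn0.ne'] at this
  have h2 := smul_le_smul_of_nonneg_left (add_le_iff_nonpos_left.1 hlow)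
    (_root_.mul_nonneg hn0.le hn0.le)
  rw [smul_zero, smul_smul, mul_assoc, mul_inv_cancel₀ hn0.ne', mul_one, smul_sub,
    smul_inv_smul₀ hn0.ne', sub_nonpos] at h2
  exact h2

/-! ### The geometric mean in an `f`-algebra -/

/-- Modulo a total cone, `t a` and `t⁻¹ b` can be balanced up to the error `n⁻¹ (a + b)`. Only
`t ≥ 1` are needed for `a ≤ b`, and there `t ↦ t a - t⁻¹ b` increases by at most `n⁻¹ (a + b)`
along the steps of the grid `1 + k / n`. -/
theorem IsTotalCone.exists_balance {Q : Set F} (hQ : IsTotalCone Q) {a b : F} (ha : 0 ≤ a)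
    (hb : 0 ≤ b) {n : ℕ} (hn : 1 ≤ n) :
    ∃ t : ℝ, 0 < t ∧ a + b - (n : ℝ) • (t • a - t⁻¹ • b) ∈ Q ∧
      a + b + (n : ℝ) • (t • a - t⁻¹ • b) ∈ Q := by
  have hn0 : (0 : ℝ) < n := by exact_mod_cast hn
  have key : ∀ {a b : F}, 0 ≤ a → 0 ≤ b → b - a ∈ Q →
      ∃ t : ℝ, 0 < t ∧ a + b - (n : ℝ) • (t • a - t⁻¹ • b) ∈ Q ∧
        a + b + (n : ℝ) • (t • a - t⁻¹ • b) ∈ Q := by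
    intro a b ha hb hab
    have hs : a + b ∈ Q := hQ.of_nonneg (add_nonneg ha hb)
    by_cases h0 : a - b ∈ Q
    · refine ⟨1, one_pos, ?_, ?_⟩
      · exact mem_of_mem_of_eq (hQ.add hs (hQ.smul hn0.le hab)) (by rw [inv_one]; module)
      · exact mem_of_mem_of_eq (hQ.add hs (hQ.smul hn0.le h0)) (by rw [inv_one]; module)
    by_cases hN : (1 + n : ℝ) • a - (1 + n : ℝ)⁻¹ • b ∈ Q
    · obtain ⟨k, -, hk, hk'⟩ := exists_lt_and_not_succ (N := n * n)
        (p := fun k : ℕ => (1 + k / n : ℝ) • a - (1 + k / n : ℝ)⁻¹ • b ∉ Q)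
        (by simpa using h0) (by
          have : ((n * n : ℕ) : ℝ) / n = n := by push_cast; field_simp
          rw [this]; simpa using hN)
      have hz := not_not.1 hk'
      have hz' := (hQ.total _).resolve_left hk
      have hkn : (0 : ℝ) ≤ k / n := by positivity
      have ht : (1 + ((k + 1 : ℕ) : ℝ) / n) = (1 + (k : ℝ) / n) + 1 / n := by
        push_cast; ring
      rw [ht] at hz
      have ht1 : (1 : ℝ) ≤ 1 + k / n := by linarith
      generalize (1 + (k : ℝ) / n) = t at *
      have hinv : (0 : ℝ) < 1 / n := by positivity
      have ht0 : 0 < t := by linarith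
      have ht' : 1 ≤ t + 1 / n := by linarith
      have hcoef : 0 ≤ 1 - n * (t⁻¹ - (t + 1 / n)⁻¹) := by
        have e : n * (t⁻¹ - (t + 1 / n)⁻¹) = (t * (t + 1 / n))⁻¹ := by
          have : t + 1 / n ≠ 0 := by positivity
          rw [inv_sub_inv ht0.ne' this]
          field_simp
          ring
        rw [e, sub_nonneg]
        exact inv_le_one_of_one_le₀ (one_le_mul_of_one_le_of_one_le ht1 ht')
      refine ⟨t + 1 / n, by positivity, ?_, ?_⟩
      · refine mem_of_mem_of_eq (hQ.add (hQ.smul hcoef (hQ.of_nonneg hb)) (hQ.smul hn0.le hz')) ?_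
        have e : (n : ℝ) * (t + 1 / n) = n * t + 1 := by field_simp
        simp only [smul_sub, smul_neg, smul_smul, e]
        module
      · exact hQ.add hs (hQ.smul hn0.le hz)
    · have hz := (hQ.total _).resolve_left hN
      refine ⟨1 + n, by positivity, ?_, ?_⟩
      · exact mem_of_mem_of_eq (hQ.add hs (hQ.smul hn0.le hz)) (by module)
      · have hc : 0 ≤ 1 - (n : ℝ) * (1 + n : ℝ)⁻¹ := by
          rw [sub_nonneg, ← div_eq_mul_inv, div_le_one (by positivity)]
          linarith
        refine mem_of_mem_of_eq (hQ.of_nonneg (add_nonneg (add_nonneg ha (smul_nonneg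
          (show 0 ≤ (n : ℝ) * (1 + n) by positivity) ha)) (smul_nonneg hc hb))) ?_
        module
  rcases hQ.total (b - a) with hab | hab
  · exact key ha hb hab
  · obtain ⟨t, ht, h1, h2⟩ := key hb ha (mem_of_mem_of_eq hab (by abel))
    refine ⟨t⁻¹, inv_pos.2 ht, mem_of_mem_of_eq h2 ?_, mem_of_mem_of_eq h1 ?_⟩ <;> rw [inv_inv] <;> module

/-- The infimum of the squares `(t a - t⁻¹ b)²` is `0`. -/
theorem IsFAlgebra.nonpos_of_le_mul_self (h : IsFAlgebra F) (hA : IsArchimedeanLattice F)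
    (hcomm : ∀ a b : F, a * b = b * a) {a b g : F} (ha : 0 ≤ a) (hb : 0 ≤ b)
    (hg : ∀ t : ℝ, 0 < t → g ≤ (t • a - t⁻¹ • b) * (t • a - t⁻¹ • b)) : g ≤ 0 := by
  have := h.isScalarTower hA
  have := h.smulCommClass hA
  have hs := h.mul_self_nonneg hcomm (a + b)
  refine hA.nonpos hs fun n hn => ?_
  have hn1 : (1 : ℝ) ≤ n := by exact_mod_cast hn
  have hn0 : (0 : ℝ) < n := by linarith
  rw [← sub_nonneg]
  refine h.nonneg_of_forall_isTotalCone fun Q hQ => ?_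
  obtain ⟨t, ht, h1, h2⟩ := hQ.exists_balance ha hb hn
  have hgt := hQ.of_nonneg (sub_nonneg.2 (hg t ht))
  have hprod := hQ.mul h hcomm h1 h2
  generalize t • a - t⁻¹ • b = z at *
  generalize a + b = s at *
  refine mem_of_mem_of_eq (hQ.add (hQ.add (hQ.smul hn0.le hgt)
    (hQ.smul (inv_nonneg.2 hn0.le) hprod))
    (hQ.smul (sub_nonneg.2 (inv_le_one_of_one_le₀ hn1)) (hQ.of_nonneg hs))) ?_
  simp only [sub_mul, mul_add, smul_mul_assoc, mul_smul_comm, smul_sub, smul_add, smul_smul,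
    inv_mul_cancel₀ hn0.ne', inv_mul_cancel_left₀ hn0.ne', one_smul, hcomm z s]
  module

theorem IsFAlgebra.isGLB_geomMeanSet_mul_self (h : IsFAlgebra F) (hA : IsArchimedeanLattice F)
    (hcomm : ∀ a b : F, a * b = b * a) {p q : F} (hp : 0 ≤ p) (hq : 0 ≤ q) :
    IsGLB (geomMeanSet (p * p) (q * q)) ((2 : ℝ) • (p * q)) := by
  have := h.isScalarTower hA
  have := h.smulCommClass hA
  have expand : ∀ t : ℝ, 0 < t → (t • p - t⁻¹ • q) * (t • p - t⁻¹ • q) =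
      (t * t) • (p * p) + (t * t)⁻¹ • (q * q) - (2 : ℝ) • (p * q) := by
    intro t ht
    have e : (2 : ℝ) • (p * q) = (2 * (t * t⁻¹)) • (p * q) := by
      rw [mul_inv_cancel₀ ht.ne', mul_one]
    simp only [e, sub_mul, mul_sub, smul_mul_assoc, mul_smul_comm, hcomm q p, mul_inv]
    module
  refine ⟨?_, fun w hw => ?_⟩
  · rintro _ ⟨θ, hθ, rfl⟩
    have hθ' : (0 : ℝ) < θ := hθ
    have h1 := h.mul_self_nonneg hcomm (√θ • p - (√θ)⁻¹ • q)
    rwa [expand _ (Real.sqrt_pos.2 hθ'), Real.mul_self_sqrt hθ'.le, sub_nonneg] at h1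
  · rw [← sub_nonpos]
    refine h.nonpos_of_le_mul_self hA hcomm hp hq fun t ht => ?_
    rw [expand t ht]
    exact sub_le_sub_right (hw ⟨t * t, mul_pos ht ht, rfl⟩) _

theorem IsGeometricMeanClosed.geomMean_nonneg (hG : IsGeometricMeanClosed F) {a b : F}
    (ha : 0 ≤ a) (hb : 0 ≤ b) : 0 ≤ geomMean a b := by
  have h1 : 0 ≤ (2 : ℝ) • geomMean a b := (hG.isGLB ha hb).2 (by
    rintro _ ⟨θ, hθ, rfl⟩
    have hθ' : (0 : ℝ) < θ := hθ
    exact add_nonneg (smul_nonneg hθ'.le ha) (smul_nonneg (inv_nonneg.2 hθ'.le) hb))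
  have := smul_nonneg (show (0 : ℝ) ≤ 2⁻¹ by norm_num) h1
  rwa [inv_smul_smul₀ two_ne_zero] at this

/-- The geometric mean squares to the product. Products of two elements of `geomMeanSet a b` are
at least `4 a b`, which passes to the infimum in each factor; and the squares of these elements
exceed `4 a b` by the squares `(θ a - θ⁻¹ b)²`, whose infimum is `0`. -/
theorem IsFAlgebra.geomMean_mul_self (h : IsFAlgebra F) (hA : IsArchimedeanLattice F)
    (hcomm : ∀ a b : F, a * b = b * a) (hG : IsGeometricMeanClosed F) {a b : F}
    (ha : 0 ≤ a) (hb : 0 ≤ b) : geomMean a b * geomMean a b = a * b := by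
  have := h.isScalarTower hA
  have := h.smulCommClass hA
  have hglb := hG.isGLB ha hb
  have hs : 0 ≤ (2 : ℝ) • geomMean a b :=
    smul_nonneg zero_le_two (hG.geomMean_nonneg ha hb)
  have hne : (geomMeanSet a b).Nonempty := ⟨_, 1, Set.mem_Ioi.2 one_pos, rfl⟩
  have hpos : ∀ c ∈ geomMeanSet a b, 0 ≤ c := fun c hc => hs.trans (hglb.1 hc)
  have prod : ∀ c ∈ geomMeanSet a b, ∀ d ∈ geomMeanSet a b, (4 : ℝ) • (a * b) ≤ c * d := by
    rintro _ ⟨θ, hθ, rfl⟩ _ ⟨φ, hφ, rfl⟩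
    have hθ' : (0 : ℝ) < θ := hθ
    have hφ' : (0 : ℝ) < φ := hφ
    have h1 := (h.isGLB_geomMeanSet_mul_self hA hcomm ha hb).1 ⟨θ * φ, mul_pos hθ' hφ', rfl⟩
    have h2 : (2 : ℝ) ≤ θ * φ⁻¹ + θ⁻¹ * φ := by
      have : θ * φ⁻¹ + θ⁻¹ * φ - 2 = (θ - φ) ^ 2 / (θ * φ) := by field_simp; ring
      have : 0 ≤ (θ - φ) ^ 2 / (θ * φ) := by positivity
      linarith
    have h3 := add_le_add h1 (smul_le_smul_of_nonneg_right h2 (h.mul_nonneg a b ha hb))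
    convert h3 using 1
    · module
    · simp only [mul_add, add_mul, smul_mul_assoc, mul_smul_comm, hcomm b a, mul_inv]
      module
  have lower : (4 : ℝ) • (a * b) ≤ ((2 : ℝ) • geomMean a b) * ((2 : ℝ) • geomMean a b) := by
    refine (h.isGLB_image_mul_right hA hne hglb hs).2 ?_
    rintro _ ⟨c, hc, rfl⟩
    change _ ≤ c * _
    rw [hcomm c]
    refine (h.isGLB_image_mul_right hA hne hglb (hpos c hc)).2 ?_
    rintro _ ⟨d, hd, rfl⟩
    exact prod d hd c hc
  have upper : ((2 : ℝ) • geomMean a b) * ((2 : ℝ) • geomMean a b) ≤ (4 : ℝ) • (a * b) := by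
    rw [← sub_nonpos]
    refine h.nonpos_of_le_mul_self hA hcomm ha hb fun t ht => ?_
    have hmem : t • a + t⁻¹ • b ∈ geomMeanSet a b := ⟨t, ht, rfl⟩
    have h1 := hglb.1 hmem
    have h2 := (h.mul_le_mul_right hs h1).trans
      ((hcomm _ _).trans_le (h.mul_le_mul_right (hpos _ hmem) h1))
    rw [sub_le_iff_le_add]
    refine h2.trans_eq ?_
    have e : (4 : ℝ) • (a * b) = (4 * (t * t⁻¹)) • (a * b) := by
      rw [mul_inv_cancel₀ ht.ne', mul_one]
    simp only [e, mul_add, add_mul, mul_sub, sub_mul, smul_mul_assoc, mul_smul_comm, hcomm b a]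
    module
  have h4 := le_antisymm upper lower
  have e : (4 : ℝ) • (geomMean a b * geomMean a b) = (4 : ℝ) • (a * b) := by
    rw [← h4, smul_mul_assoc, mul_smul_comm, smul_smul]
    norm_num
  exact smul_right_injective F (show (4 : ℝ) ≠ 0 by norm_num) e

end Cones
end VectorSeminorm

/-! ### The sharpened triangle inequality -/

theorem theorem3p5 {V F : Type*} [AddCommGroup V] [Module ℝ V]
    [Lattice F] [NonUnitalRing F] [Module ℝ F] [IsOrderedAddMonoid F] [IsOrderedModule ℝ F]
    (hArch : IsArchimedeanLattice F) (hFalg : IsFAlgebra F)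
    (hSemi : IsSemiprime F) (hGM : IsGeometricMeanClosed F)
    (T : V →ₗ[ℝ] V →ₗ[ℝ] F) (hT : IsVectorSemiInner T)
    (u : F) (hu : 0 ≤ u) (x y : V) :
    ∃ m : F,
      IsGLB ((fun l : ℝ => |l|⁻¹ • (vnorm T u (l • x - y) * vnorm T u (l • x - y))) ''
        {l : ℝ | l ≠ 0}) m ∧
      vnorm T u (x + y) * vnorm T u (x + y) ≤
        (vnorm T u x + vnorm T u y) * (vnorm T u x + vnorm T u y) - m ∧
      (vnorm T u x + vnorm T u y) * (vnorm T u x + vnorm T u y) - m ≤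
        (vnorm T u x + vnorm T u y) * (vnorm T u x + vnorm T u y) ∧
      (vnorm T u (x + y) * vnorm T u (x + y) =
          (vnorm T u x + vnorm T u y) * (vnorm T u x + vnorm T u y) - m ↔
        0 ≤ T x y * u) := by
  have := hFalg.isScalarTower hArch
  have hcomm := hFalg.mul_comm hArch hSemi
  have hsq : ∀ z : V, vnorm T u z * vnorm T u z = T z z * u := fun z =>
    hFalg.geomMean_mul_self hArch hcomm hGM (hT.nonneg z) hu
  have hp : 0 ≤ vnorm T u x := hGM.geomMean_nonneg (hT.nonneg x) hu
  have hq : 0 ≤ vnorm T u y := hGM.geomMean_nonneg (hT.nonneg y) hu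
  have hglb := hFalg.isGLB_geomMeanSet_mul_self hArch hcomm hp hq
  have hN : ∀ l : ℝ, vnorm T u (l • x - y) * vnorm T u (l • x - y) =
      (l * l) • (vnorm T u x * vnorm T u x) - (2 * l) • (T x y * u)
        + vnorm T u y * vnorm T u y := by
    intro l
    rw [hsq, hsq, hsq]
    simp only [map_sub, map_smul, LinearMap.sub_apply, LinearMap.smul_apply, hT.symm y x, sub_mul,
      smul_mul_assoc, smul_sub]
    module
  have hadd : vnorm T u (x + y) * vnorm T u (x + y) =
      vnorm T u x * vnorm T u x + (2 : ℝ) • (T x y * u) + vnorm T u y * vnorm T u y := by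
    rw [hsq, hsq, hsq]
    simp only [map_add, LinearMap.add_apply, hT.symm y x, add_mul]
    module
  have hpq : (vnorm T u x + vnorm T u y) * (vnorm T u x + vnorm T u y) =
      vnorm T u x * vnorm T u x + (2 : ℝ) • (vnorm T u x * vnorm T u y)
        + vnorm T u y * vnorm T u y := by
    rw [add_mul, mul_add, mul_add, hcomm (vnorm T u y) (vnorm T u x)]
    module
  have hnn : ∀ l : ℝ, 0 ≤ |l|⁻¹ • (vnorm T u (l • x - y) * vnorm T u (l • x - y)) := fun l =>
    smul_nonneg (by positivity) (hFalg.mul_self_nonneg hcomm _)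
  -- The values at `θ` and at `-θ` are those of `geomMeanSet`, shifted by `∓ 2 T(x, y) u`.
  have hval_pos : ∀ θ : ℝ, 0 < θ →
      |θ|⁻¹ • (vnorm T u (θ • x - y) * vnorm T u (θ • x - y)) =
        θ • (vnorm T u x * vnorm T u x) + θ⁻¹ • (vnorm T u y * vnorm T u y)
          - (2 : ℝ) • (T x y * u) := by
    intro θ hθ
    have e : θ⁻¹ * (2 * θ) = 2 := by field_simp
    rw [hN, abs_of_pos hθ]
    simp only [smul_add, smul_sub, smul_smul, inv_mul_cancel_left₀ hθ.ne', e]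
    abel
  have hval_neg : ∀ θ : ℝ, 0 < θ →
      |-θ|⁻¹ • (vnorm T u ((-θ) • x - y) * vnorm T u ((-θ) • x - y)) =
        θ • (vnorm T u x * vnorm T u x) + θ⁻¹ • (vnorm T u y * vnorm T u y)
          + (2 : ℝ) • (T x y * u) := by
    intro θ hθ
    have e : θ⁻¹ * (2 * θ) = 2 := by field_simp
    rw [hN, abs_neg, abs_of_pos hθ]
    rw [neg_mul_neg, mul_neg, neg_smul, sub_neg_eq_add]
    simp only [smul_add, smul_smul, inv_mul_cancel_left₀ hθ.ne', e]
    abel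
  generalize vnorm T u x = p at *
  generalize vnorm T u y = q at *
  generalize T x y * u = c at *
  have hm : IsGLB ((fun l : ℝ => |l|⁻¹ • (vnorm T u (l • x - y) * vnorm T u (l • x - y))) ''
      {l : ℝ | l ≠ 0}) ((2 : ℝ) • (p * q) - (2 : ℝ) • |c|) := by
    constructor
    · rintro _ ⟨l, hl, rfl⟩
      rcases lt_or_gt_of_ne hl with hneg | hpos
      · have hpos : 0 < -l := neg_pos.2 hneg
        have := hval_neg (-l) hpos
        rw [neg_neg] at this
        change _ ≤ |l|⁻¹ • _
        rw [this, sub_eq_add_neg, ← smul_neg]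
        exact add_le_add (hglb.1 ⟨-l, hpos, rfl⟩)
          (smul_le_smul_of_nonneg_left (neg_le.1 (neg_le_abs c)) zero_le_two)
      · change _ ≤ |l|⁻¹ • _
        rw [hval_pos l hpos]
        exact sub_le_sub (hglb.1 ⟨l, hpos, rfl⟩)
          (smul_le_smul_of_nonneg_left (le_abs_self c) zero_le_two)
    · intro w hw
      have h1 : w + (2 : ℝ) • c ≤ (2 : ℝ) • (p * q) := hglb.2 (by
        rintro _ ⟨θ, hθ, rfl⟩
        have := hw ⟨θ, ne_of_gt hθ, rfl⟩
        change w ≤ |θ|⁻¹ • _ at this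
        rwa [hval_pos θ hθ, le_sub_iff_add_le] at this)
      have h2 : w - (2 : ℝ) • c ≤ (2 : ℝ) • (p * q) := hglb.2 (by
        rintro _ ⟨θ, hθ, rfl⟩
        have := hw ⟨-θ, neg_ne_zero.2 (ne_of_gt hθ), rfl⟩
        change w ≤ |-θ|⁻¹ • _ at this
        rwa [hval_neg θ hθ, ← sub_le_iff_le_add] at this)
      have h3 : |c| ≤ (2 : ℝ)⁻¹ • ((2 : ℝ) • (p * q) - w) := by
        refine abs_le'.2 ⟨?_, ?_⟩ <;> rw [le_inv_smul_iff_of_pos two_pos, le_sub_iff_add_le]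
        · rwa [add_comm]
        · rwa [smul_neg, add_comm, ← sub_eq_add_neg]
      rwa [le_inv_smul_iff_of_pos two_pos, le_sub_comm] at h3
  have hm0 : 0 ≤ (2 : ℝ) • (p * q) - (2 : ℝ) • |c| := hm.2 (by
    rintro _ ⟨l, -, rfl⟩
    exact hnn l)
  have hdiff : (p + q) * (p + q) - ((2 : ℝ) • (p * q) - (2 : ℝ) • |c|) -
      (p * p + (2 : ℝ) • c + q * q) = (2 : ℝ) • (|c| - c) := by
    rw [hpq]
    module
  refine ⟨_, hm, ?_, sub_le_self _ hm0, ?_⟩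
  · rw [hadd, ← sub_nonneg, hdiff]
    exact smul_nonneg zero_le_two (sub_nonneg.2 (le_abs_self c))
  · rw [hadd, eq_comm, ← sub_eq_zero, hdiff, smul_eq_zero_iff_right two_ne_zero, sub_eq_zero]
    exact ⟨fun hc => hc ▸ abs_nonneg c, fun hc => abs_of_nonneg hc⟩
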